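/- Let $(R,\mathfrak m)$ be a commutative noetherian local ring, let $E$ be an injective hull of the residue field $k=R/\mathfrak m$, and for an $R$-module $X$ let $X^\circ=\operatorname{Hom}_R(X,E)$ be its Matlis dual. Call an $R$-module $M$ (Matlis-)reflexive if the canonical map $\varphi_M\colon M\to M^{\circ\circ}$, $\varphi_M(m)(f)=f(m)$, is an isomorphism. Let $M$ be any $R$-module. If there exists a monomorphism of $R$-modules $M^{\circ\circ}\hookrightarrow M$, then $M$ is reflexive. Likewise, if there exists an epimorphism of $R$-modules $M\twoheadrightarrow M^{\circ\circ}$, then $M$ is reflexive. -/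

import Mathlib

universe u v w

/-- `i : N → E` exhibits `E` as an injective hull of the `R`-module `N`: it is an embedding into an
injective module whose image is essential, i.e. meets every nonzero submodule of `E`
nontrivially. -/
structure IsInjectiveHull {R E : Type u} {N : Type w} [CommRing R] [AddCommGroup E] [Module R E]
    [AddCommGroup N] [Module R N] (i : N →ₗ[R] E) : Prop where
  injective_module : Module.Injective R E
  injective_map : Function.Injective i
  essential : ∀ U : Submodule R E, U ⊓ LinearMap.range i = ⊥ → U = ⊥

/-- The dual `Hom_R(M, E)` of `M` with respect to `E`. For `R` noetherian local and `E` an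
injective hull of the residue field it is the Matlis dual of `M`. -/
abbrev MatlisDual (R : Type u) (E : Type w) (M : Type v) [CommRing R] [AddCommGroup E] [Module R E]
    [AddCommGroup M] [Module R M] :=
  M →ₗ[R] E

/-- The canonical map from `M` to its bidual: `m ↦ (f ↦ f m)`. -/
def matlisEval (R : Type u) (E : Type w) (M : Type v) [CommRing R] [AddCommGroup E] [Module R E]
    [AddCommGroup M] [Module R M] : M →ₗ[R] MatlisDual R E (MatlisDual R E M) :=
  LinearMap.applyₗ

/-- `M` is (Matlis-)reflexive if the canonical map from `M` to its bidual is bijective. -/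
def IsMatlisReflexive (R : Type u) (E : Type w) (M : Type v) [CommRing R] [AddCommGroup E]
    [Module R E] [AddCommGroup M] [Module R M] : Prop :=
  Function.Bijective (matlisEval R E M)

/-!
The idea is that a proper inclusion `M → M°°` makes `M` absorb a copy of some `R ⧸ p`, which forces
`M` to have infinite rank along `p`; but biduality raises infinite ranks.

Let `C` be the cokernel of `M → M°°`. The canonical map `M° → M°°°` is split by the dual of
`M → M°°`, so `M°°° ≅ M° × C°`, and dually `M°° × C°°` embeds in `M°°°°`. If `M°°` embeds in `M`,
then `M°°°°` embeds in `M°°`, hence in `M`, and therefore `M × C` embeds in `M`. If `C ≠ 0`, choose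
an associated prime `p` of `C`; then `M × (R ⧸ p)` embeds in `M`.

Let `⨁_ι R ⧸ p` be a direct sum of largest possible cardinality embedded in `M`: it exists because
the `p`-torsion of `M` has a rank over the domain `R ⧸ p`. Since `M × (R ⧸ p)` embeds in `M`, the
set `ι` is infinite. Every ultrafilter `U` on `ι` gives a linear limit `(ι → E) → E`, and hence a
copy of `R ⧸ p` in `M°°`, by taking the limit along `U` of the values of a functional on the
summands. Copies belonging to different ultrafilters are independent
(`exists_injective_finsupp_ultrafilter_bidual`), and an infinite `ι` carries more than `#ι`
ultrafilters (`exists_injective_set_ultrafilter`). So `M°°`, and with it `M`, contains a larger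
direct sum of copies of `R ⧸ p`, a contradiction.

The case of an epimorphism `M → M°°` follows by duality: it embeds `M°°°` in `M°`, so `M°` is
reflexive, and then `M°°° ≅ M° × C°` gives `C° = 0`, whence `C = 0` as `E` is a cogenerator.
-/

/-! ### Ultrafilters on an infinite set -/

open Cardinal in
/-- An infinite set carries more ultrafilters than it has elements. -/
theorem exists_injective_set_ultrafilter (ι : Type v) [Infinite ι] :
    ∃ f : Set ι → Ultrafilter ι, Function.Injective f := by
  classical
  have hcard : #(Finset ι × Finset ι) = #ι := by
    rw [← mul_def, mk_finset_of_infinite, mul_eq_self (aleph0_le_mk ι)]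
  obtain ⟨e⟩ := Cardinal.eq.1 hcard
  -- Restrict the traces `F ∩ X` of a subset `X` to larger and larger finite sets `F`.
  let V : Ultrafilter (Finset ι) := Ultrafilter.of Filter.atTop
  let τ : Set ι → Finset ι → ι := fun X F ↦ e (F, F.filter (· ∈ X))
  refine ⟨fun X ↦ V.map (τ X), fun X Y hXY ↦ Set.ext fun a ↦ ?_⟩
  have hY : Set.range (τ Y) ∈ V.map (τ X) := by
    rw [show V.map (τ X) = V.map (τ Y) from hXY]
    exact Filter.range_mem_map
  have ha : ∀ᶠ F in (V : Filter (Finset ι)), {a} ≤ F :=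
    (Filter.eventually_ge_atTop {a}).filter_mono (Ultrafilter.of_le Filter.atTop)
  obtain ⟨F, ⟨G, hG⟩, haF⟩ := (Filter.Eventually.and (Ultrafilter.mem_map.1 hY) ha).exists
  have hFG := e.injective hG
  rw [Prod.mk.injEq] at hFG
  obtain ⟨rfl, hG⟩ := hFG
  have := Finset.ext_iff.1 hG a
  have haG : a ∈ G := haF (Finset.mem_singleton_self a)
  simpa [haG] using this.symm

/-- Finitely many ultrafilters different from `U` are separated from `U` by one set. -/
theorem Ultrafilter.exists_mem_forall_notMem {ι : Type*} (U : Ultrafilter ι)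
    (F : Finset (Ultrafilter ι)) :
    ∃ T ∈ U, ∀ V ∈ F, V ≠ U → T ∉ V := by
  have h : ∀ V : Ultrafilter ι, ∃ T ∈ U, V ≠ U → T ∉ V := by
    intro V
    by_cases hV : V = U
    · exact ⟨Set.univ, Filter.univ_mem, fun h ↦ (h hV).elim⟩
    · by_contra! hcon
      exact hV (Ultrafilter.coe_le_coe.1 fun T hT ↦ (hcon T hT).2)
  choose T hTU hTV using h
  refine ⟨⋂ V ∈ F, T V, (Filter.biInter_finset_mem F).2 fun V _ ↦ hTU V, fun V hV hne hmem ↦ ?_⟩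
  exact hTV V hne (Filter.mem_of_superset hmem (Set.biInter_subset_of_mem hV))

/-! ### Duality with respect to an injective cogenerator -/

section Cogenerator

variable {R : Type u} [CommRing R] {E : Type u} [AddCommGroup E] [Module R E]

/-- An injective module `E` over a local ring containing the residue field is a cogenerator. -/
theorem exists_dual_apply_ne_zero [IsLocalRing R] (hB : Module.Baer R E)
    (i : IsLocalRing.ResidueField R →ₗ[R] E) (hi : Function.Injective i)
    {X : Type*} [AddCommGroup X] [Module R X] {x : X} (hx : x ≠ 0) :
    ∃ h : X →ₗ[R] E, h x ≠ 0 := by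
  let s := LinearMap.toSpanSingleton R X x
  have hker : LinearMap.ker s ≤ IsLocalRing.maximalIdeal R := by
    refine IsLocalRing.le_maximalIdeal fun htop ↦ hx ?_
    have h1 : (1 : R) ∈ LinearMap.ker s := htop ▸ Submodule.mem_top
    simpa [s] using h1
  let q : R →ₗ[R] IsLocalRing.ResidueField R := (IsLocalRing.maximalIdeal R).mkQ
  obtain ⟨h, hh⟩ := hB.extension_property ((LinearMap.ker s).liftQ s le_rfl)
    (LinearMap.ker_eq_bot.1 (Submodule.ker_liftQ_eq_bot _ _ _ le_rfl))
    (i ∘ₗ (LinearMap.ker s).liftQ q (hker.trans (Submodule.ker_mkQ _).ge))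
  refine ⟨h, fun h0 ↦ ?_⟩
  have h1 := LinearMap.congr_fun hh (Submodule.Quotient.mk 1)
  simp only [LinearMap.comp_apply, Submodule.liftQ_apply] at h1
  rw [show s 1 = x by simp [s], h0, eq_comm, map_eq_zero_iff i hi] at h1
  exact one_ne_zero (α := IsLocalRing.ResidueField R) h1

theorem matlisEval_injective [IsLocalRing R] (hB : Module.Baer R E)
    (i : IsLocalRing.ResidueField R →ₗ[R] E) (hi : Function.Injective i)
    (X : Type*) [AddCommGroup X] [Module R X] : Function.Injective (matlisEval R E X) := by
  rw [injective_iff_map_eq_zero]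
  intro x hx
  by_contra hne
  obtain ⟨h, hh⟩ := exists_dual_apply_ne_zero hB i hi hne
  exact hh (LinearMap.congr_fun hx h)

theorem dual_map_surjective (hB : Module.Baer R E) {X Y : Type*} [AddCommGroup X] [Module R X]
    [AddCommGroup Y] [Module R Y] {f : X →ₗ[R] Y} (hf : Function.Injective f) :
    Function.Surjective (LinearMap.lcomp R E f) := fun g ↦ hB.extension_property f hf g

theorem dual_map_injective {X Y : Type*} [AddCommGroup X] [Module R X]
    [AddCommGroup Y] [Module R Y] {f : X →ₗ[R] Y} (hf : Function.Surjective f) :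
    Function.Injective (LinearMap.lcomp R E f) := fun _ _ h ↦ LinearMap.cancel_right hf |>.1 h

/-! ### Ultrafilter limits and large direct sums in the bidual -/

/-- An ultrafilter `U` on `ι` has a linear limit `(ι → E) → E` if `E` is injective: extend the
identity of `E` along the diagonal embedding of `E` in its ultrapower. -/
theorem exists_linear_ultrafilter_limit (hB : Module.Baer R E) {ι : Type*} (U : Ultrafilter ι) :
    ∃ ψ : (ι → E) →ₗ[R] E, ∀ (g : ι → E) (e : E),
      (∀ᶠ s in (U : Filter ι), g s = e) → ψ g = e := by
  let N : Submodule R (ι → E) :=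
    { carrier := {g | ∀ᶠ s in (U : Filter ι), g s = 0}
      add_mem' := fun ha hb ↦ by
        filter_upwards [ha, hb] with s h1 h2
        simp [h1, h2]
      zero_mem' := Filter.Eventually.of_forall fun _ ↦ rfl
      smul_mem' := fun r g hg ↦ by
        filter_upwards [hg] with s h1
        simp [h1] }
  let δ : E →ₗ[R] (ι → E) := LinearMap.pi fun _ ↦ LinearMap.id
  have hδ : Function.Injective (N.mkQ ∘ₗ δ) := by
    rw [injective_iff_map_eq_zero]
    intro e he
    have he' : ∀ᶠ _ in (U : Filter ι), e = 0 := (Submodule.Quotient.mk_eq_zero N).1 he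
    exact he'.exists.choose_spec
  obtain ⟨h, hh⟩ := hB.extension_property _ hδ LinearMap.id
  refine ⟨h ∘ₗ N.mkQ, fun g e hg ↦ ?_⟩
  have hmem : g - δ e ∈ N := by
    change ∀ᶠ s in (U : Filter ι), g s - e = 0
    filter_upwards [hg] with s hs
    rw [hs, sub_self]
  have heq : N.mkQ g = N.mkQ (δ e) := (Submodule.Quotient.eq N).2 hmem
  rw [LinearMap.comp_apply, heq]
  exact LinearMap.congr_fun hh e

/-- A direct sum of copies of `A` indexed by `ι` in `M` gives a direct sum of copies of `A` indexed
by the ultrafilters on `ι` in the bidual of `M`. -/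
theorem exists_injective_finsupp_ultrafilter_bidual [IsLocalRing R] (hB : Module.Baer R E)
    (i : IsLocalRing.ResidueField R →ₗ[R] E) (hi : Function.Injective i)
    {A M ι : Type*} [AddCommGroup A] [Module R A] [AddCommGroup M] [Module R M]
    (L : (ι →₀ A) →ₗ[R] M) (hL : Function.Injective L) :
    ∃ L' : (Ultrafilter ι →₀ A) →ₗ[R] MatlisDual R E (MatlisDual R E M),
      Function.Injective L' := by
  classical
  choose ψ hψ using fun U : Ultrafilter ι ↦ exists_linear_ultrafilter_limit hB U
  -- `Λ U a` sends a functional `h` to the limit along `U` of its values on the copies of `a`.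
  let Λ : Ultrafilter ι → A →ₗ[R] MatlisDual R E (MatlisDual R E M) := fun U ↦
    LinearMap.mk₂ R (fun a h ↦ ψ U fun s ↦ h (L (Finsupp.single s a)))
      (fun a b h ↦ by rw [← map_add]; congr 1; ext s; simp)
      (fun r a h ↦ by rw [← map_smul]; congr 1; ext s; simp [← Finsupp.smul_single])
      (fun a h h' ↦ by rw [← map_add]; rfl)
      (fun r a h ↦ by rw [← map_smul]; rfl)
  refine ⟨Finsupp.lsum R Λ, (injective_iff_map_eq_zero _).2 fun x hx ↦ ?_⟩
  by_contra hne
  obtain ⟨U, hU⟩ := Finsupp.ne_iff.1 hne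
  obtain ⟨T, hTU, hT⟩ := U.exists_mem_forall_notMem x.support
  obtain ⟨h₀, hh₀⟩ := exists_dual_apply_ne_zero hB i hi hU
  -- A functional that is `h₀` on the copies indexed by `T` and zero on the others isolates `U`.
  obtain ⟨h, hh⟩ := hB.extension_property L hL
    (Finsupp.lsum R fun s ↦ if s ∈ T then h₀ else 0)
  have hval : ∀ s a, h (L (Finsupp.single s a)) = if s ∈ T then h₀ a else 0 := by
    intro s a
    have := LinearMap.congr_fun hh (Finsupp.single s a)
    rw [LinearMap.comp_apply, Finsupp.lsum_single] at this
    rw [this]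
    split_ifs <;> simp
  have hsum : (Finsupp.lsum R Λ x) h = Λ U (x U) h := by
    rw [Finsupp.lsum_apply, Finsupp.sum, LinearMap.sum_apply]
    refine Finset.sum_eq_single U (fun V hV hVU ↦ ?_) fun hU' ↦ (hU (by simpa using hU')).elim
    refine hψ V _ 0 ?_
    filter_upwards [Ultrafilter.compl_mem_iff_notMem.2 (hT V hV hVU)] with s hs
    rw [hval, if_neg hs]
  refine hh₀ ?_
  rw [hx, LinearMap.zero_apply] at hsum
  rw [hsum]
  refine (hψ U _ _ ?_).symm
  filter_upwards [hTU] with s hs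
  rw [hval, if_pos hs]

/-! ### The fourth dual -/

/-- The canonical map of the dual of `X` is a section of the dual of `matlisEval R E X`, so the
triple dual maps onto the dual of `X` times the dual of the cokernel of `matlisEval R E X`; the
embedding is the dual of that surjection. No assumption on `E` is needed. -/
theorem exists_injective_bidual_prod_bidual (X : Type*) [AddCommGroup X] [Module R X] :
    ∃ j : (MatlisDual R E (MatlisDual R E X) ×
        MatlisDual R E (MatlisDual R E
          (MatlisDual R E (MatlisDual R E X) ⧸ LinearMap.range (matlisEval R E X)))) →ₗ[R]
        MatlisDual R E (MatlisDual R E (MatlisDual R E (MatlisDual R E X))),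
      Function.Injective j := by
  let φ := matlisEval R E X
  let P := LinearMap.range φ
  let σ := LinearMap.lcomp R E φ
  let e := matlisEval R E (MatlisDual R E X)
  have hle : ∀ z, P ≤ LinearMap.ker (z - e (σ z)) := by
    rintro z _ ⟨x, rfl⟩
    exact sub_self (z (φ x))
  -- The projection of the triple dual onto the dual of the cokernel.
  let ρ : MatlisDual R E (MatlisDual R E (MatlisDual R E X)) →ₗ[R]
      MatlisDual R E (MatlisDual R E (MatlisDual R E X) ⧸ P) :=
    { toFun := fun z ↦ P.liftQ (z - e (σ z)) (hle z)
      map_add' := fun a b ↦ by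
        ext t
        simp only [map_add, LinearMap.comp_apply, LinearMap.add_apply, Submodule.mkQ_apply,
          Submodule.liftQ_apply, LinearMap.sub_apply]
        abel
      map_smul' := fun r a ↦ by
        ext t
        simp [smul_sub] }
  have hsurj : Function.Surjective (σ.prod ρ) := by
    rintro ⟨y, γ⟩
    have hσ : σ (e y + γ ∘ₗ P.mkQ) = y := by
      ext x
      have h0 : P.mkQ (φ x) = 0 := (Submodule.Quotient.mk_eq_zero P).2 ⟨x, rfl⟩
      change y x + γ (P.mkQ (φ x)) = y x
      rw [h0, map_zero, add_zero]
    refine ⟨e y + γ ∘ₗ P.mkQ, Prod.ext hσ ?_⟩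
    change P.liftQ _ _ = γ
    ext t
    simp only [LinearMap.comp_apply, Submodule.mkQ_apply, Submodule.liftQ_apply,
      hσ, add_sub_cancel_left]
  refine ⟨LinearMap.lcomp R E (σ.prod ρ) ∘ₗ (LinearMap.coprodEquiv R).toLinearMap,
    (dual_map_injective hsurj).comp (LinearEquiv.injective _)⟩

end Cogenerator

/-! ### Maximal direct sums and reflexivity -/

open Cardinal in
/-- Among the direct sums of copies of `R ⧸ p` embedded in `M`, there is one of maximal
cardinality. -/
theorem exists_injective_finsupp_quotient_maximal {R : Type u} [CommRing R] (p : Ideal R)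
    [p.IsPrime] (M : Type v) [AddCommGroup M] [Module R M] :
    ∃ (ι : Type v) (L : (ι →₀ R ⧸ p) →ₗ[R] M), Function.Injective L ∧
      ∀ (κ : Type v) (L' : (κ →₀ R ⧸ p) →ₗ[R] M), Function.Injective L' → #κ ≤ #ι := by
  let N := Submodule.torsionBySet R M p
  obtain ⟨s, hs, hli⟩ := exists_set_linearIndependent_of_isDomain (R ⧸ p) N
  refine ⟨s, N.subtype ∘ₗ (Finsupp.linearCombination (R ⧸ p) ((↑) : s → N)).restrictScalars R,
    N.injective_subtype.comp hli, fun κ L' hL' ↦ ?_⟩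
  have hmem : ∀ x, L' x ∈ N := by
    intro x
    rw [Submodule.mem_torsionBySet_iff]
    rintro ⟨a, ha⟩
    rw [← map_smul]
    have h0 : a • x = 0 := by
      ext t
      rw [Finsupp.smul_apply, Finsupp.zero_apply, Algebra.smul_def,
        Ideal.Quotient.algebraMap_eq, Ideal.Quotient.eq_zero_iff_mem.2 ha, zero_mul]
    exact (congrArg L' h0).trans (map_zero L')
  let K : (κ →₀ R ⧸ p) →ₗ[R ⧸ p] N :=
    (L'.codRestrict N hmem).extendScalarsOfSurjective Ideal.Quotient.mk_surjective
  have hK : Function.Injective K := fun a b hab ↦ hL' (congrArg Subtype.val hab)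
  have h := LinearMap.lift_rank_le_of_injective K hK
  rw [rank_finsupp_self, ← hs] at h
  simpa using h

open Cardinal in
theorem isMatlisReflexive_of_injective {R : Type u} [CommRing R] [IsLocalRing R]
    [IsNoetherianRing R] {E : Type u} [AddCommGroup E] [Module R E] (hB : Module.Baer R E)
    (i : IsLocalRing.ResidueField R →ₗ[R] E) (hi : Function.Injective i)
    {M : Type v} [AddCommGroup M] [Module R M]
    (f : MatlisDual R E (MatlisDual R E M) →ₗ[R] M) (hf : Function.Injective f) :
    IsMatlisReflexive R E M := by
  refine ⟨matlisEval_injective hB i hi M, LinearMap.range_eq_top.1 ?_⟩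
  rw [← Submodule.Quotient.subsingleton_iff]
  by_contra hC
  rw [not_subsingleton_iff_nontrivial] at hC
  obtain ⟨p, hp⟩ := associatedPrimes.nonempty R
    (MatlisDual R E (MatlisDual R E M) ⧸ LinearMap.range (matlisEval R E M))
  obtain ⟨hprime, c, hc⟩ := (isAssociatedPrime_iff_exists_injective_linearMap _ _).1 hp
  obtain ⟨j, hj⟩ := exists_injective_bidual_prod_bidual (R := R) (E := E) M
  -- The bidual of `f` embeds the fourth dual of `M` in the bidual.
  have hff : Function.Injective (LinearMap.lcomp R E (LinearMap.lcomp R E f)) :=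
    dual_map_injective (dual_map_surjective hB hf)
  let a : (M × (R ⧸ p)) →ₗ[R] M := f ∘ₗ LinearMap.lcomp R E (LinearMap.lcomp R E f) ∘ₗ j ∘ₗ
    (matlisEval R E M).prodMap (matlisEval R E _ ∘ₗ c)
  have ha : Function.Injective a := by
    refine hf.comp (hff.comp (hj.comp ?_))
    exact (matlisEval_injective hB i hi M).prodMap ((matlisEval_injective hB i hi _).comp hc)
  obtain ⟨ι, L, hL, hmax⟩ := exists_injective_finsupp_quotient_maximal p M
  have hinf : Infinite ι := by
    by_contra hfin
    rw [not_infinite_iff_finite] at hfin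
    -- A finite maximal direct sum in `M` could be enlarged by one copy through `a`.
    let b : (PUnit.{v + 1} →₀ R ⧸ p) ≃ₗ[R] R ⧸ p :=
      Finsupp.uniqueLinearEquiv R _ PUnit.unit
    have h := hmax (ι ⊕ PUnit.{v + 1})
      (a ∘ₗ L.prodMap b.toLinearMap ∘ₗ (Finsupp.sumFinsuppLEquivProdFinsupp R).toLinearMap)
      (ha.comp ((hL.prodMap b.injective).comp (LinearEquiv.injective _)))
    obtain ⟨n, hn⟩ := lt_aleph0.1 (mk_lt_aleph0 (α := ι))
    rw [mk_sum, lift_id, lift_id, mk_punit, hn] at h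
    exact Nat.not_succ_le_self n (by exact_mod_cast h)
  obtain ⟨L', hL'⟩ := exists_injective_finsupp_ultrafilter_bidual hB i hi L hL
  obtain ⟨u, hu⟩ := exists_injective_set_ultrafilter ι
  have h := hmax (Set ι) (f ∘ₗ L' ∘ₗ Finsupp.lmapDomain (R ⧸ p) R u)
    (hf.comp (hL'.comp (Finsupp.mapDomain_injective hu)))
  rw [mk_set] at h
  exact (cantor #ι).not_ge h

theorem isMatlisReflexive_of_dual {R : Type u} [CommRing R] [IsLocalRing R]
    {E : Type u} [AddCommGroup E] [Module R E] (hB : Module.Baer R E)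
    (i : IsLocalRing.ResidueField R →ₗ[R] E) (hi : Function.Injective i)
    {M : Type v} [AddCommGroup M] [Module R M] (h : IsMatlisReflexive R E (MatlisDual R E M)) :
    IsMatlisReflexive R E M := by
  refine ⟨matlisEval_injective hB i hi M, fun z ↦ ?_⟩
  set P := LinearMap.range (matlisEval R E M)
  by_contra hz
  have hne : P.mkQ z ≠ 0 := fun h0 ↦ hz ((Submodule.Quotient.mk_eq_zero P).1 h0)
  obtain ⟨γ, hγ⟩ := exists_dual_apply_ne_zero hB i hi hne
  -- The functional `γ ∘ P.mkQ` is evaluation at some `y`; as it vanishes on `M`, `y = 0`.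
  obtain ⟨y, hy⟩ := h.2 (γ ∘ₗ P.mkQ)
  have hy0 : y = 0 := by
    ext x
    have h0 : P.mkQ (matlisEval R E M x) = 0 := (Submodule.Quotient.mk_eq_zero P).2 ⟨x, rfl⟩
    have h1 := LinearMap.congr_fun hy (matlisEval R E M x)
    rw [LinearMap.comp_apply, h0, map_zero] at h1
    exact h1
  rw [hy0, map_zero] at hy
  exact hγ (LinearMap.congr_fun hy z).symm

theorem mainTheorem3 {R : Type u} [CommRing R] [IsLocalRing R] [IsNoetherianRing R]
    {E : Type u} [AddCommGroup E] [Module R E]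
    (i : IsLocalRing.ResidueField R →ₗ[R] E) (hE : IsInjectiveHull i)
    (M : Type v) [AddCommGroup M] [Module R M] :
    ((∃ f : MatlisDual R E (MatlisDual R E M) →ₗ[R] M, Function.Injective f) →
      IsMatlisReflexive R E M) ∧
    ((∃ g : M →ₗ[R] MatlisDual R E (MatlisDual R E M), Function.Surjective g) →
      IsMatlisReflexive R E M) := by
  have hB : Module.Baer R E := Module.Baer.of_injective hE.injective_module
  refine ⟨fun ⟨f, hf⟩ ↦ isMatlisReflexive_of_injective hB i hE.injective_map f hf,
    fun ⟨g, hg⟩ ↦ isMatlisReflexive_of_dual hB i hE.injective_map ?_⟩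
  exact isMatlisReflexive_of_injective hB i hE.injective_map (LinearMap.lcomp R E g)
    (dual_map_injective hg)
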